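/- Let $d\ge 1$ and $k\ge 0$ be integers with $k<d-1$. A deterministic quantum circuit with $k$ slots, not assumed to have a definite causal order, is a process matrix: an operator $C\ge 0$ on $\mathcal H_{\rm in}\otimes\mathcal H_{\rm out}\otimes\bigotimes_{i=1}^{k}(\mathcal I_i\otimes\mathcal O_i)$, all factors being $\mathbb C^d$, such that for all quantum channels $\mathcal I_i\to\mathcal O_i$ with Choi operators $J_1,\dots,J_k$ the link product $C*(J_1\otimes\cdots\otimes J_k)$ is the Choi operator of a quantum channel $\mathcal H_{\rm in}\to\mathcal H_{\rm out}$. (Circuits with a definite causal order, i.e. quantum combs, are special cases.) Here $A*B=\operatorname{Tr}_L[A(I\otimes B^{T})]$ for $A$ on $X\otimes L$ and $B$ on $L$. The success branch of a probabilistic heralded circuit is an operator $S$ with $0\le S\le C$ for some such $C$. For a $d\times d$ matrix $U$ let $\mathfrak C(U)=d\,(I\otimes U)|\phi^+_d\rangle\langle\phi^+_d|(I\otimes U^\dagger)$ with $|\phi^+_d\rangle=\frac1{\sqrt d}\sum_i|ii\rangle$ be its Choi operator. **Theorem.** Any universal probabilistic heralded quantum circuit (including protocols without definite causal order) transforming $k<d-1$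 uses of a $d$-dimensional unitary operation $U$ into its inverse $U^{-1}$ with a success probability $p$ that does not depend on $U$ necessarily has $p=0$. That is: if $S$ is the success branch of a probabilistic heralded circuit with $k<d-1$ slots and $p$ is a real number such that $$S*\mathfrak C(U)^{\otimes k}=p\,\mathfrak C(U^{-1})\qquad\text{for all }U\in SU(d),$$ then $p=0$. -/

import Mathlib

open scoped Kronecker ComplexOrder

/-- Partial trace over the second tensor factor. -/
noncomputable def partialTraceRight {X Y : Type*} [Fintype Y]
    (A : Matrix (X × Y) (X × Y) ℂ) : Matrix X X ℂ :=
  Matrix.of fun x x' => ∑ y, A (x, y) (x', y)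

/-- The link product `A * B = Tr_L [A (1 ⊗ Bᵀ)]` of an operator `A` on `X ⊗ L` with an operator
`B` on `L`: the `L`-systems of `A` are plugged into those of `B`. -/
noncomputable def linkProduct {X L : Type*} [Fintype X] [DecidableEq X] [Fintype L]
    (A : Matrix (X × L) (X × L) ℂ) (B : Matrix L L ℂ) : Matrix X X ℂ :=
  partialTraceRight (A * ((1 : Matrix X X ℂ) ⊗ₖ B.transpose))

/-- The tensor product `J₀ ⊗ ⋯ ⊗ J_{k-1}` of operators on the spaces `ℂ^X`. -/
noncomputable def tensorFamily {X : Type*} {k : ℕ} (J : Fin k → Matrix X X ℂ) :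
    Matrix (Fin k → X) (Fin k → X) ℂ :=
  Matrix.of fun l l' => ∏ i, J i (l i) (l' i)

/-- The maximally entangled vector `|φ⁺_d⟩ = d^{-1/2} ∑ᵢ |i i⟩`. -/
noncomputable def maxEntangled (d : ℕ) : Fin d × Fin d → ℂ :=
  fun x => if x.1 = x.2 then ((1 / Real.sqrt d : ℝ) : ℂ) else 0

/-- The Choi operator `d (1 ⊗ U) |φ⁺⟩⟨φ⁺| (1 ⊗ U†)` of the operation `ρ ↦ U ρ U†`. The first tensor
factor is the input of the operation, the second its output. -/
noncomputable def choiOperator {d : ℕ} (U : Matrix (Fin d) (Fin d) ℂ) :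
    Matrix (Fin d × Fin d) (Fin d × Fin d) ℂ :=
  (d : ℂ) • (((1 : Matrix (Fin d) (Fin d) ℂ) ⊗ₖ U) *
    Matrix.vecMulVec (maxEntangled d) (star (maxEntangled d)) *
    ((1 : Matrix (Fin d) (Fin d) ℂ) ⊗ₖ U.conjTranspose))

/-- `J` is the Choi operator of a quantum channel (completely positive trace-preserving map) on
`ℂ^d`: it is positive semidefinite, and its partial trace over the output is the identity. -/
def IsChannel {d : ℕ} (J : Matrix (Fin d × Fin d) (Fin d × Fin d) ℂ) : Prop :=
  J.PosSemidef ∧ partialTraceRight J = 1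

/-- Operators on the systems of a circuit with one `d`-dimensional input, one `d`-dimensional
output and `k` open slots for `d`-dimensional operations. An index `(x, l)` consists of
`x = (input, output)` of the circuit and `l i = (input, output)` of the operation that is
inserted in slot `i`. -/
abbrev CircuitOperator (d k : ℕ) : Type :=
  Matrix ((Fin d × Fin d) × (Fin k → Fin d × Fin d))
    ((Fin d × Fin d) × (Fin k → Fin d × Fin d)) ℂ

/-- `C` is (the Choi operator of) a deterministic quantum circuit with `k` slots, without any
assumption of a causal order between the slots, that is, a process matrix: `C` is positive
semidefinite, and inserting arbitrary channels in the slots gives a channel. Since `C` is positive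
semidefinite, this is equivalent to the same requirement for channels that act in addition on
ancillas. Circuits with a definite causal order (quantum combs) are special cases. -/
def IsProcess {d k : ℕ} (C : CircuitOperator d k) : Prop :=
  C.PosSemidef ∧
    ∀ J : Fin k → Matrix (Fin d × Fin d) (Fin d × Fin d) ℂ,
      (∀ i, IsChannel (J i)) → IsChannel (linkProduct C (tensorFamily J))

/-- `S` is the success branch of a probabilistic heralded circuit, possibly with indefinite causal
order: `0 ≤ S ≤ C` for some deterministic circuit `C` (the failure branch is `C - S`). -/
def IsHeraldedCircuit {d k : ℕ} (S : CircuitOperator d k) : Prop :=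
  ∃ C : CircuitOperator d k, IsProcess C ∧ S.PosSemidef ∧ (C - S).PosSemidef

/-- The success branch `S` transforms `k` uses of every `d`-dimensional unitary operation `U`
exactly into `U⁻¹`, with probability `p` independent of `U`. As `U` and `exp(iφ) U` are the same
operation, `U` ranges over the special unitary group. -/
def InvertsUnitaries {d k : ℕ} (S : CircuitOperator d k) (p : ℝ) : Prop :=
  ∀ U ∈ Matrix.specialUnitaryGroup (Fin d) ℂ,
    linkProduct S (tensorFamily fun _ => choiOperator U) = (p : ℂ) • choiOperator U⁻¹

/-!
Diagonal unitaries already force `p = 0`, and of the circuit only `0 ≤ S` matters.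

Write `S = Bᴴ B`, and let `x` range over the `d`-tuples of complex numbers of modulus one with
product one. Inserting the unitary `diag(x̄)` into all `k` slots turns the block of `B` belonging to
the circuit index `(i, i)` into a vector `wᵢ(x)`, whose components are homogeneous polynomials of
degree `k` in `x` (`slotPolynomial`), and the inversion property becomes
`⟨wᵢ(x), wⱼ(x)⟩ = p xᵢ x̄ⱼ`. Hence `‖xᵢ wᵢ(x) - xⱼ wⱼ(x)‖² = p - p - p + p = 0`, so that
`xᵢ wᵢ(x)` is the same vector for all `i`. By homogeneity this also holds for all tuples of complex
numbers of modulus one, so it is an identity of polynomials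
(`eq_of_isHomogeneous_of_eval_eq`). Each component of the common value is therefore a homogeneous
polynomial of degree `k + 1` divisible by every one of the `d` variables; as `k + 1 < d`, it
vanishes (`eq_zero_of_forall_X_dvd`), and `p = ‖wᵢ(x)‖² = 0`.

This is the restriction to the diagonal torus of the fact that `U⁻¹` is `det(U)⁻¹` times the
adjugate of `U`, whose entries have degree `d - 1`.
-/

/-! ### Homogeneous polynomials on the torus -/

theorem eval_smul_of_isHomogeneous {σ R : Type*} [Fintype σ] [CommSemiring R]
    {P : MvPolynomial σ R} {n : ℕ} (hP : P.IsHomogeneous n) (c : R) (x : σ → R) :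
    MvPolynomial.eval (c • x) P = c ^ n * MvPolynomial.eval x P := by
  rw [MvPolynomial.eval_eq', MvPolynomial.eval_eq', Finset.mul_sum]
  refine Finset.sum_congr rfl fun m hm => ?_
  have hdeg : n = ∑ i, m i := by
    rw [← Finsupp.degree_eq_sum]
    by_contra hne
    exact MvPolynomial.mem_support_iff.mp hm (hP.coeff_eq_zero (Ne.symm hne))
  simp only [Pi.smul_apply, smul_eq_mul, mul_pow, Finset.prod_mul_distrib,
    Finset.prod_pow_eq_pow_sum, ← hdeg]
  ring

/-- Two homogeneous polynomials of the same degree that agree on the maximal torus of `SU(d)` are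
equal: scaling by a phase extends the agreement to the torus of `U(d)`, which is a product of
infinite sets. -/
theorem eq_of_isHomogeneous_of_eval_eq {d n : ℕ} (hd : d ≠ 0) {P Q : MvPolynomial (Fin d) ℂ}
    (hP : P.IsHomogeneous n) (hQ : Q.IsHomogeneous n)
    (h : ∀ x : Fin d → ℂ, (∀ i, ‖x i‖ = 1) → ∏ i, x i = 1 →
      MvPolynomial.eval x P = MvPolynomial.eval x Q) : P = Q := by
  have hinf : (Metric.sphere (0 : ℂ) 1).Infinite :=
    (isPathConnected_sphere (by simp) 0
      zero_le_one).isConnected.isPreconnected.infinite_of_nontrivial ⟨1, by simp, -1, by simp, by norm_num⟩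
  refine MvPolynomial.funext_set (fun _ => Metric.sphere (0 : ℂ) 1) (fun _ => hinf) ?_
  intro x hx
  have hx1 : ∀ i, ‖x i‖ = 1 := fun i => by simpa using hx i (Set.mem_univ i)
  obtain ⟨c, hc⟩ := IsAlgClosed.exists_pow_nat_eq (∏ i, x i)⁻¹ (Nat.pos_of_ne_zero hd)
  have hprod : ‖∏ i, x i‖ = 1 := by simp [norm_prod, hx1]
  have hc1 : ‖c‖ = 1 := by
    refine (pow_eq_one_iff_of_nonneg (norm_nonneg c) hd).mp ?_
    rw [← norm_pow, hc, norm_inv, hprod, inv_one]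
  have hx0 : ∏ i, x i ≠ 0 := norm_ne_zero_iff.mp (by rw [hprod]; exact one_ne_zero)
  have hc0 : c ≠ 0 := norm_ne_zero_iff.mp (by rw [hc1]; exact one_ne_zero)
  have key := h (c • x) (fun i => by simp [hc1, hx1]) (by
    simp [Finset.prod_mul_distrib, hc, inv_mul_cancel₀ hx0])
  rw [eval_smul_of_isHomogeneous hP, eval_smul_of_isHomogeneous hQ] at key
  exact mul_left_cancel₀ (pow_ne_zero n hc0) key

/-- A monomial divisible by all `d` variables has degree at least `d`. -/
theorem eq_zero_of_forall_X_dvd {d n : ℕ} {F : MvPolynomial (Fin d) ℂ} (hF : F.IsHomogeneous n)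
    (hn : n < d) (h : ∀ i, MvPolynomial.X i ∣ F) : F = 0 := by
  by_contra hF0
  obtain ⟨m, hm⟩ := MvPolynomial.ne_zero_iff.mp hF0
  have hpos : ∀ i, 1 ≤ m i := fun i => by
    obtain ⟨G, hG⟩ := h i
    by_contra hi
    have hi0 : i ∉ m.support := Finsupp.notMem_support_iff.mpr (by omega)
    exact hm (by rw [hG, MvPolynomial.coeff_X_mul', if_neg hi0])
  have hdeg : m.degree = n := by
    by_contra hne
    exact hm (hF.coeff_eq_zero hne)
  have : d ≤ m.degree := by
    rw [Finsupp.degree_eq_sum]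
    simpa using Finset.sum_le_sum fun i (_ : i ∈ Finset.univ) => hpos i
  omega

/-! ### Choi operators of unitaries in the slots -/

theorem choiOperator_apply {d : ℕ} (V : Matrix (Fin d) (Fin d) ℂ) (x y : Fin d × Fin d) :
    choiOperator V x y = V x.2 x.1 * star (V y.2 y.1) := by
  have hd : (d : ℂ) ≠ 0 := by
    have := x.1.pos
    exact_mod_cast this.ne'
  have hs : ((1 / Real.sqrt d : ℝ) : ℂ) * ((1 / Real.sqrt d : ℝ) : ℂ) = (d : ℂ)⁻¹ := by
    rw [← Complex.ofReal_mul, div_mul_div_comm, one_mul, Real.mul_self_sqrt (Nat.cast_nonneg d)]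
    simp
  have hL : ((1 : Matrix (Fin d) (Fin d) ℂ) ⊗ₖ V).mulVec (maxEntangled d) x
      = V x.2 x.1 * ((1 / Real.sqrt d : ℝ) : ℂ) := by
    simp [Matrix.mulVec, dotProduct, Fintype.sum_prod_type, maxEntangled, Matrix.one_apply,
      -one_div, -Complex.ofReal_div]
  have hR : Matrix.vecMul (star (maxEntangled d))
      ((1 : Matrix (Fin d) (Fin d) ℂ) ⊗ₖ V.conjTranspose) y
      = star (V y.2 y.1) * ((1 / Real.sqrt d : ℝ) : ℂ) := by
    simp [Matrix.vecMul, dotProduct, Fintype.sum_prod_type, maxEntangled, Matrix.one_apply,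
      -one_div, -Complex.ofReal_div, apply_ite, mul_comm]
  rw [choiOperator, Matrix.smul_apply, Matrix.mul_vecMulVec, Matrix.vecMulVec_mul,
    Matrix.vecMulVec_apply, hL, hR, smul_eq_mul]
  linear_combination (d : ℂ) * V x.2 x.1 * star (V y.2 y.1) * hs +
    V x.2 x.1 * star (V y.2 y.1) * mul_inv_cancel₀ hd

/-- The Gram form of the link product: for `S = Bᴴ B`, the tensor power of the rank-one operator
`choiOperator U` is contracted with each factor separately. -/
theorem linkProduct_conjTranspose_mul_self {d k : ℕ} (B : CircuitOperator d k)
    (U : Matrix (Fin d) (Fin d) ℂ) (x y : Fin d × Fin d) :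
    linkProduct (B.conjTranspose * B) (tensorFamily fun _ : Fin k => choiOperator U) x y =
      ∑ a, star (∑ l, B a (x, l) * ∏ i, star (U (l i).2 (l i).1)) *
        ∑ l, B a (y, l) * ∏ i, star (U (l i).2 (l i).1) := by
  have h1 : linkProduct (B.conjTranspose * B) (tensorFamily fun _ : Fin k => choiOperator U) x y =
      ∑ l, ∑ l', (∑ a, star (B a (x, l)) * B a (y, l')) *
        ((∏ i, U (l i).2 (l i).1) * ∏ i, star (U (l' i).2 (l' i).1)) := by
    simp only [linkProduct, partialTraceRight, Matrix.of_apply]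
    refine Finset.sum_congr rfl fun l _ => ?_
    rw [Matrix.mul_apply, Fintype.sum_prod_type, Finset.sum_eq_single y]
    · refine Finset.sum_congr rfl fun l' _ => ?_
      rw [Matrix.mul_apply]
      simp [tensorFamily, choiOperator_apply, Finset.prod_mul_distrib]
    · intro b _ hb
      simp [hb]
    · simp
  rw [h1]
  simp only [star_sum, star_mul', star_prod, star_star, Finset.sum_mul, Finset.mul_sum]
  -- The Gram form carries the sum over the rows `a` of `B` outside, `h1` carries it inside.
  rw [Finset.sum_congr rfl fun l _ => Finset.sum_comm, Finset.sum_comm]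
  refine Finset.sum_congr rfl fun a _ => ?_
  rw [Finset.sum_comm]
  refine Finset.sum_congr rfl fun l' _ => Finset.sum_congr rfl fun l _ => ?_
  ring

/-- The `a`-th component of the vector obtained by inserting a diagonal unitary into all slots of the
block `(i, i)` of `B`. The link product conjugates the inserted matrix, so the variables stand for
the complex conjugates of its diagonal entries (see `eval_slotPolynomial`). -/
noncomputable def slotPolynomial {d k : ℕ} (B : CircuitOperator d k)
    (a : (Fin d × Fin d) × (Fin k → Fin d × Fin d)) (i : Fin d) : MvPolynomial (Fin d) ℂ :=
  ∑ l, MvPolynomial.C (B a ((i, i), l)) *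
    ∏ j, Matrix.diagonal (MvPolynomial.X : Fin d → MvPolynomial (Fin d) ℂ) (l j).2 (l j).1

theorem isHomogeneous_slotPolynomial {d k : ℕ} (B : CircuitOperator d k)
    (a : (Fin d × Fin d) × (Fin k → Fin d × Fin d)) (i : Fin d) :
    (slotPolynomial B a i).IsHomogeneous k := by
  refine MvPolynomial.IsHomogeneous.sum _ _ _ fun l _ => ?_
  refine MvPolynomial.IsHomogeneous.C_mul ?_ _
  have := MvPolynomial.IsHomogeneous.prod Finset.univ
    (fun j => Matrix.diagonal (MvPolynomial.X : Fin d → MvPolynomial (Fin d) ℂ) (l j).2 (l j).1)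
    (fun _ => 1) (fun j _ => by
      rw [Matrix.diagonal_apply]
      split_ifs
      · exact MvPolynomial.isHomogeneous_X _ _
      · exact MvPolynomial.isHomogeneous_zero _ _ _)
  simpa using this

theorem eval_slotPolynomial {d k : ℕ} (B : CircuitOperator d k)
    (a : (Fin d × Fin d) × (Fin k → Fin d × Fin d)) (i : Fin d) (x : Fin d → ℂ) :
    MvPolynomial.eval x (slotPolynomial B a i) =
      ∑ l, B a ((i, i), l) * ∏ j, star (Matrix.diagonal (star x) (l j).2 (l j).1) := by
  simp only [slotPolynomial, map_sum, map_mul, MvPolynomial.eval_C, map_prod]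
  refine Finset.sum_congr rfl fun l _ => congrArg _ (Finset.prod_congr rfl fun j _ => ?_)
  by_cases h : (l j).2 = (l j).1 <;> simp [h]

/-! ### Inversion of diagonal unitaries -/

theorem sum_star_eval_slotPolynomial_mul {d k : ℕ} {B : CircuitOperator d k} {p : ℝ}
    (hp : InvertsUnitaries (B.conjTranspose * B) p) {x : Fin d → ℂ} (hx : ∀ i, ‖x i‖ = 1)
    (hdet : ∏ i, x i = 1) (i j : Fin d) :
    ∑ a, star (MvPolynomial.eval x (slotPolynomial B a i)) *
      MvPolynomial.eval x (slotPolynomial B a j) = p * (x i * star (x j)) := by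
  have hxx : ∀ i, x i * star (x i) = 1 := fun i => by
    simpa [hx i] using Complex.mul_conj' (x i)
  have hinv : Matrix.diagonal x * Matrix.diagonal (star x) = 1 := by
    rw [Matrix.diagonal_mul_diagonal, ← Matrix.diagonal_one]
    exact congrArg _ (funext hxx)
  have hU : Matrix.diagonal (star x) ∈ Matrix.specialUnitaryGroup (Fin d) ℂ := by
    rw [Matrix.mem_specialUnitaryGroup_iff, Matrix.mem_unitaryGroup_iff']
    refine ⟨?_, ?_⟩
    · rw [Matrix.star_eq_conjTranspose, Matrix.diagonal_conjTranspose, star_star, hinv]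
    · rw [Matrix.det_diagonal, ← star_one ℂ, ← hdet, star_prod]
      rfl
  have h := congrFun (congrFun (hp _ hU) (i, i)) (j, j)
  rw [linkProduct_conjTranspose_mul_self, Matrix.inv_eq_left_inv hinv, Matrix.smul_apply,
    choiOperator_apply] at h
  simpa only [eval_slotPolynomial, Matrix.diagonal_apply_eq, smul_eq_mul] using h

/-- The vectors `xᵢ wᵢ(x)` and `xⱼ wⱼ(x)` both have squared norm `p`, and so has their inner
product. -/
theorem X_mul_slotPolynomial_eq {d k : ℕ} {B : CircuitOperator d k} {p : ℝ}
    (hp : InvertsUnitaries (B.conjTranspose * B) p)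
    (a : (Fin d × Fin d) × (Fin k → Fin d × Fin d)) (i j : Fin d) :
    MvPolynomial.X i * slotPolynomial B a i = MvPolynomial.X j * slotPolynomial B a j := by
  have hom : ∀ i, (MvPolynomial.X i * slotPolynomial B a i).IsHomogeneous (1 + k) := fun i =>
    (MvPolynomial.isHomogeneous_X ℂ i).mul (isHomogeneous_slotPolynomial B a i)
  refine eq_of_isHomogeneous_of_eval_eq i.pos.ne' (hom i) (hom j) fun x hx hdet => ?_
  have hxx : ∀ i, x i * star (x i) = 1 := fun i => by
    simpa [hx i] using Complex.mul_conj' (x i)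
  have hg := sum_star_eval_slotPolynomial_mul hp hx hdet
  simp only [map_mul, MvPolynomial.eval_X]
  set w : ((Fin d × Fin d) × (Fin k → Fin d × Fin d)) → Fin d → ℂ :=
    fun a i => MvPolynomial.eval x (slotPolynomial B a i) with hw
  have hsum : ∑ a, star (x i * w a i - x j * w a j) * (x i * w a i - x j * w a j) = 0 := by
    have hexp : ∀ a, star (x i * w a i - x j * w a j) * (x i * w a i - x j * w a j) =
        x i * star (x i) * (star (w a i) * w a i) - star (x i) * x j * (star (w a i) * w a j)
        - star (x j) * x i * (star (w a j) * w a i)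
        + x j * star (x j) * (star (w a j) * w a j) := fun a => by
      rw [star_sub, star_mul', star_mul']
      ring
    rw [Finset.sum_congr rfl fun a _ => hexp a, Finset.sum_add_distrib, Finset.sum_sub_distrib,
      Finset.sum_sub_distrib, ← Finset.mul_sum, ← Finset.mul_sum, ← Finset.mul_sum,
      ← Finset.mul_sum, hg i i, hg i j, hg j i, hg j j]
    linear_combination (p * (x i * star (x i)) - p * (x j * star (x j))) * hxx i +
      (p * (x j * star (x j)) - p * (x i * star (x i))) * hxx j
  have hzero := (Finset.sum_eq_zero_iff_of_nonneg fun a _ => star_mul_self_nonneg _).mp hsum a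
    (Finset.mem_univ a)
  exact sub_eq_zero.mp ((mul_eq_zero.mp hzero).elim star_eq_zero.mp id)

open scoped MatrixOrder in
theorem exists_eq_conjTranspose_mul_self {n : Type*} [Fintype n] {A : Matrix n n ℂ}
    (hA : A.PosSemidef) : ∃ B : Matrix n n ℂ, A = B.conjTranspose * B := by
  classical
  exact CStarAlgebra.nonneg_iff_eq_star_mul_self.mp hA.nonneg

theorem theorem3 (d k : ℕ) (hk : k < d - 1) (S : CircuitOperator d k) (hS : IsHeraldedCircuit S)
    (p : ℝ) (hp : InvertsUnitaries S p) : p = 0 := by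
  obtain ⟨-, -, hS, -⟩ := hS
  obtain ⟨B, rfl⟩ := exists_eq_conjTranspose_mul_self hS
  have hzero : ∀ a i, slotPolynomial B a i = 0 := fun a i => by
    have hF : MvPolynomial.X i * slotPolynomial B a i = 0 :=
      eq_zero_of_forall_X_dvd
        ((MvPolynomial.isHomogeneous_X ℂ i).mul (isHomogeneous_slotPolynomial B a i)) (by omega)
        fun j => ⟨_, X_mul_slotPolynomial_eq hp a i j⟩
    exact (mul_eq_zero.mp hF).resolve_left (MvPolynomial.X_ne_zero i)
  -- The identity matrix, inserted into all slots, has success probability `0`.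
  have h := sum_star_eval_slotPolynomial_mul hp (x := 1) (by simp) (by simp)
    ⟨0, by omega⟩ ⟨0, by omega⟩
  simpa [hzero] using h.symm
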